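/- Let $V:\mathbb{R}\to\mathbb{C}$ be a measurable potential such that $\int_{\mathbb{R}}|V(x)|\,e^{\gamma x}\,dx<\infty$ for every $\gamma\in\mathbb{R}$. Let $H=-\frac{d^2}{dx^2}+V$, acting in $L^2(\mathbb{R})$ by $Hf=-f''+Vf$ on the domain of all $f\in W^{1,2}(\mathbb{R})$ such that $f'$ is locally absolutely continuous and $-f''+Vf\in L^2(\mathbb{R})$ (if $V\in L^2(\mathbb{R})$, this domain is $W^{2,2}(\mathbb{R})$). Then $H$ has only finitely many eigenvalues, and every eigenvalue $\lambda\in\mathbb{C}$ of $H$, including the real ones, satisfies $$|\lambda|\le \frac94\,\|V\|_1^2 ,\qquad \|V\|_1=\int_{\mathbb{R}}|V(x)|\,dx .$$ -/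

import Mathlib

open MeasureTheory

noncomputable section

/-- The Hilbert space `L²(ℝ)` of complex-valued square integrable functions (up to a.e. equality). -/
abbrev L2R : Type := Lp ℂ 2 (volume : Measure ℝ)

/-- `u` is differentiable on `ℝ` with derivative `v`, and `v` is locally absolutely continuous
with `v' = w` almost everywhere; that is, `v` is an indefinite integral of the locally integrable
function `w`. Thus `u, u'` are locally absolutely continuous, `u' = v` and `u'' = w`. -/
structure HasACSecondDeriv (u v w : ℝ → ℂ) : Prop where
  hasDerivAt : ∀ x, HasDerivAt u (v x) x
  locallyIntegrable : LocallyIntegrable w volume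
  integral_eq : ∀ a b : ℝ, ∫ x in a..b, w x = v b - v a

namespace HasACSecondDeriv

theorem intervalIntegrable {u v w : ℝ → ℂ} (h : HasACSecondDeriv u v w) (a b : ℝ) :
    IntervalIntegrable w volume a b :=
  (h.locallyIntegrable.integrableOn_isCompact isCompact_uIcc).intervalIntegrable

theorem zero : HasACSecondDeriv 0 0 0 where
  hasDerivAt x := hasDerivAt_const x (0 : ℂ)
  locallyIntegrable := locallyIntegrable_zero
  integral_eq a b := by simp

theorem add {u v w u' v' w' : ℝ → ℂ} (h : HasACSecondDeriv u v w)
    (h' : HasACSecondDeriv u' v' w') : HasACSecondDeriv (u + u') (v + v') (w + w') where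
  hasDerivAt x := (h.hasDerivAt x).add (h'.hasDerivAt x)
  locallyIntegrable := h.locallyIntegrable.add h'.locallyIntegrable
  integral_eq a b := by
    simp only [Pi.add_apply]
    rw [intervalIntegral.integral_add (h.intervalIntegrable a b)
      (h'.intervalIntegrable a b), h.integral_eq, h'.integral_eq]
    ring

theorem smul {u v w : ℝ → ℂ} (c : ℂ) (h : HasACSecondDeriv u v w) :
    HasACSecondDeriv (c • u) (c • v) (c • w) where
  hasDerivAt x := (h.hasDerivAt x).const_smul c
  locallyIntegrable := h.locallyIntegrable.smul c
  integral_eq a b := by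
    simp only [Pi.smul_apply]
    rw [intervalIntegral.integral_smul, h.integral_eq, smul_sub]

theorem continuous {u v w : ℝ → ℂ} (h : HasACSecondDeriv u v w) : Continuous u :=
  continuous_iff_continuousAt.2 fun x => (h.hasDerivAt x).continuousAt

theorem continuous_deriv {u v w : ℝ → ℂ} (h : HasACSecondDeriv u v w) : Continuous v := by
  have h1 : v = fun x => v 0 + ∫ t in (0 : ℝ)..x, w t := by
    funext x
    rw [h.integral_eq]
    ring
  rw [h1]
  exact continuous_const.add (intervalIntegral.continuous_primitive
    (fun a b => h.intervalIntegrable a b) 0)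

/-- The second derivative of the zero function vanishes almost everywhere. -/
theorem ae_eq_zero {u v w : ℝ → ℂ} (h : HasACSecondDeriv u v w) (hu : u = 0) :
    w =ᵐ[volume] 0 := by
  have hv : ∀ x, v x = 0 := fun x =>
    (h.hasDerivAt x).unique (by rw [hu]; exact hasDerivAt_const x (0 : ℂ))
  filter_upwards [LocallyIntegrable.ae_hasDerivAt_integral h.locallyIntegrable] with x hx
  have h2 := hx 0
  simp only [h.integral_eq, hv, sub_zero] at h2
  exact h2.unique (hasDerivAt_const x (0 : ℂ))

end HasACSecondDeriv

/-- The graph of the Schrödinger operator `H = -d²/dx² + V` in `L²(ℝ)`: the pairs `(f, g)` such that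
`f` lies in the Sobolev space `W^{1,2}(ℝ)` (`f` and `f'` are square integrable), `f'` is locally
absolutely continuous, and `g = -f'' + V f` almost everywhere. -/
def schrodingerGraph (V : ℝ → ℂ) : Submodule ℂ (L2R × L2R) where
  carrier := {p | ∃ u v w : ℝ → ℂ, HasACSecondDeriv u v w ∧ p.1 =ᵐ[volume] u ∧
    MemLp v 2 volume ∧ p.2 =ᵐ[volume] fun x => -w x + V x * u x}
  zero_mem' := by
    refine ⟨0, 0, 0, HasACSecondDeriv.zero, Lp.coeFn_zero _ _ _, MemLp.zero, ?_⟩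
    filter_upwards [Lp.coeFn_zero ℂ 2 (volume : Measure ℝ)] with x hx
    rw [Prod.snd_zero, hx]
    simp
  add_mem' := by
    rintro p q ⟨u, v, w, h, hu, hv, hg⟩ ⟨u', v', w', h', hu', hv', hg'⟩
    refine ⟨u + u', v + v', w + w', h.add h', ?_, hv.add hv', ?_⟩
    · exact (Lp.coeFn_add p.1 q.1).trans (hu.add hu')
    · filter_upwards [Lp.coeFn_add p.2 q.2, hg, hg'] with x h1 h2 h3
      rw [Prod.snd_add, h1, Pi.add_apply, h2, h3]
      simp only [Pi.add_apply]
      ring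
  smul_mem' := by
    rintro c p ⟨u, v, w, h, hu, hv, hg⟩
    refine ⟨c • u, c • v, c • w, h.smul c, ?_, hv.const_smul c, ?_⟩
    · exact (Lp.coeFn_smul c p.1).trans (hu.const_smul c)
    · filter_upwards [Lp.coeFn_smul c p.2, hg] with x h1 h2
      rw [Prod.smul_snd, h1, Pi.smul_apply, h2]
      simp only [Pi.smul_apply, smul_eq_mul]
      ring

/-- `schrodingerGraph V` is the graph of an operator. -/
theorem schrodingerGraph_snd_eq_zero (V : ℝ → ℂ) (p : L2R × L2R)
    (hp : p ∈ schrodingerGraph V) (h0 : p.1 = 0) : p.2 = 0 := by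
  obtain ⟨u, v, w, h, hu, -, hg⟩ := hp
  have hu0 : u = 0 := by
    refine (Continuous.ae_eq_iff_eq volume h.continuous continuous_const).1 ?_
    rw [h0] at hu
    exact hu.symm.trans (Lp.coeFn_zero _ _ _)
  have hw := h.ae_eq_zero hu0
  refine Lp.ext ?_
  filter_upwards [hg, hw, Lp.coeFn_zero ℂ 2 (volume : Measure ℝ)] with x h1 h2 h3
  rw [h1, h2, h3, hu0]
  simp

/-- The Schrödinger operator `H = -d²/dx² + V`, as an unbounded operator in `L²(ℝ)`. Its domain
consists of the `f ∈ W^{1,2}(ℝ)` with `f'` locally absolutely continuous and `-f'' + V f ∈ L²(ℝ)`. -/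
def schrodinger (V : ℝ → ℂ) : L2R →ₗ.[ℂ] L2R := (schrodingerGraph V).toLinearPMap

theorem schrodinger_graph (V : ℝ → ℂ) : (schrodinger V).graph = schrodingerGraph V :=
  Submodule.toLinearPMap_graph_eq _ (schrodingerGraph_snd_eq_zero V)

/-- `lam` is an eigenvalue of the (unbounded) operator `A`. -/
def IsEigenvalue (A : L2R →ₗ.[ℂ] L2R) (lam : ℂ) : Prop :=
  ∃ f : A.domain, (f : L2R) ≠ 0 ∧ A f = lam • (f : L2R)

/-- A function which together with its derivative is square integrable is bounded. -/
theorem HasACSecondDeriv.bounded {u v w : ℝ → ℂ} (h : HasACSecondDeriv u v w)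
    (hu : MemLp u 2 volume) (hv : MemLp v 2 volume) : ∃ C : ℝ, ∀ x, ‖u x‖ ≤ C := by
  have hu2 : Integrable (fun x => ‖u x‖ ^ 2) volume := hu.integrable_norm_pow two_ne_zero
  have hv2 : Integrable (fun x => ‖v x‖ ^ 2) volume := hv.integrable_norm_pow two_ne_zero
  have key : ∀ (g : ℝ → ℂ), Continuous g → Integrable (fun x => ‖g x‖ ^ 2) volume → ∀ x : ℝ,
      ∫ t in x..(x + 1), ‖g t‖ ≤ 1 + ∫ t, ‖g t‖ ^ 2 := by
    intro g hg hg2 x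
    have hx : x ≤ x + 1 := by linarith
    calc ∫ t in x..(x + 1), ‖g t‖ ≤ ∫ t in x..(x + 1), (1 + ‖g t‖ ^ 2) := by
          refine intervalIntegral.integral_mono_on hx (hg.norm.intervalIntegrable _ _)
            (Continuous.intervalIntegrable (by fun_prop) _ _) fun t _ => ?_
          nlinarith [sq_nonneg (‖g t‖ - 1), norm_nonneg (g t)]
      _ = 1 + ∫ t in x..(x + 1), ‖g t‖ ^ 2 := by
          rw [intervalIntegral.integral_add (by simp)
            (Continuous.intervalIntegrable (by fun_prop) _ _)]
          simp
      _ ≤ 1 + ∫ t, ‖g t‖ ^ 2 := by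
          rw [intervalIntegral.integral_of_le hx]
          exact add_le_add_right (setIntegral_le_integral hg2
            (Filter.Eventually.of_forall fun t => sq_nonneg ‖g t‖)) 1
  have hvc := h.continuous_deriv
  have huc := h.continuous
  refine ⟨(1 + ∫ t, ‖v t‖ ^ 2) + (1 + ∫ t, ‖u t‖ ^ 2), fun x => ?_⟩
  have hx : x ≤ x + 1 := by linarith
  have hpt : ∀ y ∈ Set.Icc x (x + 1), ‖u x‖ ≤ (1 + ∫ t, ‖v t‖ ^ 2) + ‖u y‖ := by
    intro y hy
    have h1 : ∫ t in x..y, v t = u y - u x :=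
      intervalIntegral.integral_eq_sub_of_hasDerivAt (fun t _ => h.hasDerivAt t)
        (hvc.intervalIntegrable _ _)
    have h2 : ‖∫ t in x..y, v t‖ ≤ ∫ t in x..y, ‖v t‖ :=
      intervalIntegral.norm_integral_le_integral_norm hy.1
    have h3 : ∫ t in x..y, ‖v t‖ ≤ ∫ t in x..(x + 1), ‖v t‖ :=
      intervalIntegral.integral_mono_interval le_rfl hy.1 hy.2
        (Filter.Eventually.of_forall fun t => norm_nonneg _) (hvc.norm.intervalIntegrable _ _)
    have h4 : ‖u x‖ ≤ ‖u y - u x‖ + ‖u y‖ := by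
      have := norm_sub_le (u y) (u y - u x)
      rw [sub_sub_cancel] at this
      linarith
    rw [h1] at h2
    linarith [key v hvc hv2 x]
  have h5 : ∫ _ in x..(x + 1), ‖u x‖ ≤
      ∫ y in x..(x + 1), ((1 + ∫ t, ‖v t‖ ^ 2) + ‖u y‖) :=
    intervalIntegral.integral_mono_on hx (Continuous.intervalIntegrable (by fun_prop) _ _)
      (Continuous.intervalIntegrable (by fun_prop) _ _) hpt
  rw [intervalIntegral.integral_add (by simp) (huc.norm.intervalIntegrable _ _)] at h5
  simp only [intervalIntegral.integral_const, add_sub_cancel_left, one_smul] at h5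
  linarith [key u huc hu2 x]

/-- If `V` is square integrable, the domain of `H` is the Sobolev space `W^{2,2}(ℝ)`: the functions
`f` such that `f`, `f'` are locally absolutely continuous and `f`, `f'`, `f''` are square
integrable. -/
theorem mem_schrodinger_domain_iff {V : ℝ → ℂ} (hV : MemLp V 2 volume) (f : L2R) :
    f ∈ (schrodinger V).domain ↔ ∃ u v w : ℝ → ℂ, HasACSecondDeriv u v w ∧ f =ᵐ[volume] u ∧
      MemLp v 2 volume ∧ MemLp w 2 volume := by
  have hVu : ∀ u v w : ℝ → ℂ, HasACSecondDeriv u v w → f =ᵐ[volume] u → MemLp v 2 volume →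
      MemLp (fun x => V x * u x) 2 volume := by
    intro u v w h hu hv
    obtain ⟨C, hC⟩ := h.bounded ((memLp_congr_ae hu).1 (Lp.memLp f)) hv
    refine MemLp.of_le_mul (c := C) hV
      (hV.1.mul h.continuous.aestronglyMeasurable) (Filter.Eventually.of_forall fun x => ?_)
    rw [norm_mul, mul_comm]
    gcongr
    exact hC x
  rw [LinearPMap.mem_domain_iff, schrodinger_graph]
  constructor
  · rintro ⟨g, u, v, w, h, hu, hv, hg⟩
    refine ⟨u, v, w, h, hu, hv, ?_⟩
    refine (memLp_congr_ae ?_).1 ((hVu u v w h hu hv).sub (Lp.memLp g))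
    filter_upwards [hg] with x hx
    simp only [Pi.sub_apply]
    rw [hx]
    ring
  · rintro ⟨u, v, w, h, hu, hv, hw⟩
    have hm : MemLp (fun x => -w x + V x * u x) 2 volume := hw.neg.add (hVu u v w h hu hv)
    exact ⟨hm.toLp _, u, v, w, h, hu, hv, hm.coeFn_toLp⟩

end

/-!
Write an eigenvalue as `-κ²` with `Re κ ≥ 0`, and let `u` be an eigenfunction. The functions
`e^{κx}(u' - κu)` and `e^{-κx}(u' + κu)` have the integrable derivatives `e^{κx}Vu` and `e^{-κx}Vu`.
As `u` and `u'` are square integrable, the first vanishes at `-∞` and the second at `+∞`; subtracting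
their integral representations gives `2κu(x) = -∫ e^{-κ|x-t|} V(t)u(t) dt`
(`HasACSecondDeriv.two_mul_mul_eq`). This also holds for imaginary `κ`, that is, for positive
eigenvalues. Multiplying by `V` and integrating yields `2|κ| ≤ ‖V‖₁`
(`HasACSecondDeriv.two_mul_norm_le`), so that in fact `|λ| ≤ ‖V‖₁² / 4`.

For finiteness, `g = e^{-κx}u` solves the Volterra equation
`g(x) = c + ∫_{-∞}^x (1 - e^{-2κ(x-t)}) / (2κ) · V(t)g(t) dt` with `2κc = -∫ Vg`
(`HasACSecondDeriv.exp_neg_mul_eq`). By the super-exponential decay of `V`, this equation is uniquely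
solvable for all `κ` in any given disc around `0`, in the space of continuous functions of growth
`e^{2R|x|}`: a Gronwall weight makes the integral operator `T_κ` a contraction
(`norm_volterra_le`). The operator depends analytically on `κ`, and so do the normalized solution
`m_κ` (with `c = 1`) and the Jost function `D(κ) = 2κ + ∫ V m_κ` (`differentiableOn_jostFunction`).
Uniqueness gives `g = c m_κ`, hence `c ≠ 0` and `c D(κ) = 0`
(`HasACSecondDeriv.jostFunction_eq_zero`). Finally `D(κ) ≠ 0` for real `κ > ‖V‖₁`
(`jostFunction_ofReal_ne_zero`), so `D` has only finitely many zeros in the disc to which the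
eigenvalue bound confines `κ`.
-/

open Set Filter Topology
open scoped BoundedContinuousFunction

/-! ### Absolutely continuous functions and eigenfunctions at infinity -/

theorem AbsolutelyContinuousOnInterval.of_dist_le {X Y : Type*} [PseudoMetricSpace X]
    [PseudoMetricSpace Y] {f : ℝ → X} {g : ℝ → Y} {a b : ℝ}
    (hg : AbsolutelyContinuousOnInterval g a b)
    (h : ∀ x ∈ uIcc a b, ∀ y ∈ uIcc a b, dist (f x) (f y) ≤ dist (g x) (g y)) :
    AbsolutelyContinuousOnInterval f a b := by
  rw [absolutelyContinuousOnInterval_iff] at hg ⊢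
  intro ε hε
  obtain ⟨δ, hδ, H⟩ := hg ε hε
  refine ⟨δ, hδ, fun E hE hlt => lt_of_le_of_lt (Finset.sum_le_sum fun i hi => ?_) (H E hE hlt)⟩
  exact h _ (hE.1 i hi).1 _ (hE.1 i hi).2

theorem IntervalIntegrable.absolutelyContinuousOnInterval_primitive {E : Type*}
    [NormedAddCommGroup E] [NormedSpace ℝ E] {f : ℝ → E} {a b : ℝ}
    (hf : IntervalIntegrable f volume a b) :
    AbsolutelyContinuousOnInterval (fun x => ∫ t in a..x, f t) a b := by
  refine (hf.norm.absolutelyContinuousOnInterval_intervalIntegral left_mem_uIcc).of_dist_le ?_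
  intro x hx y hy
  have hs : ∀ z ∈ uIcc a b, IntervalIntegrable f volume a z := fun z hz =>
    hf.mono_set (uIcc_subset_uIcc left_mem_uIcc hz)
  rw [dist_eq_norm, dist_eq_norm, intervalIntegral.integral_interval_sub_left (hs x hx) (hs y hy),
    intervalIntegral.integral_interval_sub_left (hs x hx).norm (hs y hy).norm, Real.norm_eq_abs]
  exact intervalIntegral.norm_integral_le_abs_integral_norm

/-- The fundamental theorem of calculus for absolutely continuous functions with values in a
Banach space, the derivative being given almost everywhere. -/
theorem AbsolutelyContinuousOnInterval.integral_eq_sub_of_ae_hasDerivAt {E : Type*}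
    [NormedAddCommGroup E] [NormedSpace ℝ E] [CompleteSpace E] {f f' : ℝ → E} {a b : ℝ}
    (hf : AbsolutelyContinuousOnInterval f a b) (hf' : IntervalIntegrable f' volume a b)
    (hd : ∀ᵐ x, x ∈ uIcc a b → HasDerivAt f (f' x) x) :
    ∫ x in a..b, f' x = f b - f a := by
  obtain ⟨C, hC⟩ := (hf.fun_sub
    hf'.absolutelyContinuousOnInterval_primitive).const_of_ae_hasDerivAt_zero (by
      filter_upwards [hd, hf'.ae_hasDerivAt_integral] with x h1 h2 h3
      simpa using (h1 h3).fun_sub (h2 h3 a left_mem_uIcc))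
  have ha := hC a left_mem_uIcc
  have hb := hC b right_mem_uIcc
  simp only [intervalIntegral.integral_same, sub_zero] at ha
  rw [ha, ← hb]
  abel

/-- If `u' = v` and `v' = w`, then `e^{κx}(v - κu)` has derivative `e^{κx}(w - κ²u)`; this is the
integrated form. -/
theorem HasACSecondDeriv.integral_exp_mul {u v w : ℝ → ℂ} (h : HasACSecondDeriv u v w) (κ : ℂ)
    (a b : ℝ) : ∫ t in a..b, Complex.exp (κ * t) * (w t - κ ^ 2 * u t) =
      Complex.exp (κ * b) * (v b - κ * u b) - Complex.exp (κ * a) * (v a - κ * u a) := by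
  have hexp : ∀ x : ℝ, HasDerivAt (fun t : ℝ => Complex.exp (κ * t)) (Complex.exp (κ * x) * κ) x :=
    fun x => by
      have := ((hasDerivAt_id x).ofReal_comp.const_mul κ).cexp
      simpa using this
  have hu : AbsolutelyContinuousOnInterval u a b := by
    refine ContDiffOn.absolutelyContinuousOnInterval (ContDiff.contDiffOn ?_)
    refine contDiff_one_iff_deriv.2 ⟨fun x => (h.hasDerivAt x).differentiableAt, ?_⟩
    rw [funext fun x => (h.hasDerivAt x).deriv]
    exact h.continuous_deriv
  have hv : AbsolutelyContinuousOnInterval v a b := by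
    refine (h.intervalIntegrable a b).absolutelyContinuousOnInterval_primitive.of_dist_le ?_
    intro x _ y _
    simp only [h.integral_eq, dist_sub_right, le_refl]
  have he : AbsolutelyContinuousOnInterval (fun t : ℝ => Complex.exp (κ * t)) a b := by
    refine ContDiffOn.absolutelyContinuousOnInterval (ContDiff.contDiffOn ?_)
    exact (contDiff_const.mul Complex.ofRealCLM.contDiff).cexp
  have hvd : ∀ᵐ x, HasDerivAt v (w x) x := by
    filter_upwards [LocallyIntegrable.ae_hasDerivAt_integral h.locallyIntegrable] with x hx
    have h2 := hx 0
    simp only [h.integral_eq] at h2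
    simpa using h2.add_const (v 0)
  refine AbsolutelyContinuousOnInterval.integral_eq_sub_of_ae_hasDerivAt
    (f := fun t : ℝ => Complex.exp (κ * t) * (v t - κ * u t))
    (he.fun_smul (hv.fun_sub (hu.const_smul κ))) ?_ ?_
  · refine IntervalIntegrable.continuousOn_mul ((h.intervalIntegrable a b).sub ?_) ?_
    · exact (continuous_const.mul h.continuous).intervalIntegrable _ _
    · fun_prop
  · filter_upwards [hvd] with x hx _
    exact ((hexp x).fun_mul (hx.fun_sub ((h.hasDerivAt x).const_mul κ))).congr_deriv (by ring)

/-- A limit at infinity of a function dominated by a square integrable one is zero. The filter `l`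
stands for `atTop` or `atBot`. -/
theorem eq_zero_of_tendsto_of_norm_le_memLp {y A : ℝ → ℂ} {L : ℂ} {l : Filter ℝ}
    (hl : ∀ s ∈ l, volume s = ⊤) (hy : MemLp y 2 volume) (hA : Tendsto A l (𝓝 L))
    (hle : ∀ᶠ x in l, ‖A x‖ ≤ ‖y x‖) : L = 0 := by
  by_contra hL
  have hL' : 0 < ‖L‖ := norm_pos_iff.2 hL
  have h2 : Integrable (fun x => ‖y x‖ ^ 2) volume := hy.integrable_norm_pow two_ne_zero
  have hfin := h2.measure_norm_ge_lt_top (ε := (‖L‖ / 2) ^ 2) (by positivity)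
  refine hfin.ne (hl _ ?_)
  have hev : ∀ᶠ x in l, ‖L‖ / 2 < ‖A x‖ := hA.norm.eventually (lt_mem_nhds (by linarith))
  filter_upwards [hev, hle] with x h3 h4
  simp only [norm_pow, norm_norm]
  gcongr
  linarith

theorem volume_eq_top_of_mem_atBot {s : Set ℝ} (hs : s ∈ (atBot : Filter ℝ)) : volume s = ⊤ := by
  obtain ⟨a, ha⟩ := mem_atBot_sets.1 hs
  exact top_unique (Real.volume_Iic (a := a) ▸ measure_mono fun x hx => ha x hx)

theorem volume_eq_top_of_mem_atTop {s : Set ℝ} (hs : s ∈ (atTop : Filter ℝ)) : volume s = ⊤ := by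
  obtain ⟨a, ha⟩ := mem_atTop_sets.1 hs
  exact top_unique (Real.volume_Ici (a := a) ▸ measure_mono fun x hx => ha x hx)

/-- A potential all of whose exponential moments are finite. -/
def HasExpMoments (V : ℝ → ℂ) : Prop :=
  ∀ γ : ℝ, Integrable (fun x : ℝ => V x * ((Real.exp (γ * x) : ℝ) : ℂ)) volume

namespace HasExpMoments

variable {V : ℝ → ℂ}

theorem integrable (hV : HasExpMoments V) : Integrable V volume := by
  simpa using hV 0

theorem integrable_mul (hV : HasExpMoments V) {g : ℝ → ℂ} (hg : Continuous g) {C a : ℝ}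
    (hle : ∀ x, ‖g x‖ ≤ C * Real.exp (a * |x|)) : Integrable (fun x => V x * g x) volume := by
  refine Integrable.mono' (((hV a).norm.add (hV (-a)).norm).const_mul C)
    (hV.integrable.1.mul hg.aestronglyMeasurable) (Eventually.of_forall fun x => ?_)
  simp only [norm_mul, Pi.add_apply, Complex.norm_real, Real.norm_eq_abs, Real.abs_exp]
  have hC : 0 ≤ C := by
    have := (norm_nonneg _).trans (hle 0)
    simpa using this
  have h1 : Real.exp (a * |x|) ≤ Real.exp (a * x) + Real.exp (-a * x) := by
    rcases abs_cases x with ⟨h, _⟩ | ⟨h, _⟩ <;> rw [h]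
    · linarith [Real.exp_pos (-a * x)]
    · rw [mul_neg, ← neg_mul]
      linarith [Real.exp_pos (a * x)]
  calc ‖V x‖ * ‖g x‖ ≤ ‖V x‖ * (C * (Real.exp (a * x) + Real.exp (-a * x))) := by
        gcongr
        exact (hle x).trans (by gcongr)
    _ = _ := by ring

theorem integrable_mul_exp (hV : HasExpMoments V) {u : ℝ → ℂ} (hu : Continuous u) {C : ℝ}
    (hC : ∀ x, ‖u x‖ ≤ C) (κ : ℂ) :
    Integrable (fun t : ℝ => Complex.exp (κ * t) * (V t * u t)) volume := by
  have := hV.integrable_mul (g := fun t : ℝ => Complex.exp (κ * t) * u t) (C := C) (a := |κ.re|)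
    (by fun_prop) (fun x => by
      rw [norm_mul, Complex.norm_exp, mul_comm]
      gcongr
      · exact (norm_nonneg _).trans (hC 0)
      · exact hC x
      · rw [← abs_mul]
        simpa using le_abs_self (κ.re * x))
  refine this.congr (Eventually.of_forall fun x => ?_)
  simp only
  ring

end HasExpMoments

/-- A solution `u ∈ W^{1,2}` of `-u'' + Vu = -κ²u` with `Re κ ≥ 0`: the function `e^{κx}(u' - κu)`
is the primitive of `e^{κx}Vu` vanishing at `-∞`. -/
theorem HasACSecondDeriv.exp_mul_eq_integral_Iic {V u v w : ℝ → ℂ} (hV : HasExpMoments V)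
    (h : HasACSecondDeriv u v w) (hu : MemLp u 2 volume) (hv : MemLp v 2 volume) {κ : ℂ}
    (hκ : 0 ≤ κ.re) (hw : ∀ᵐ x, w x - κ ^ 2 * u x = V x * u x) (x : ℝ) :
    Complex.exp (κ * x) * (v x - κ * u x) = ∫ t in Iic x, Complex.exp (κ * t) * (V t * u t) := by
  obtain ⟨C, hC⟩ := h.bounded hu hv
  have hint := hV.integrable_mul_exp h.continuous hC κ
  have h1 := intervalIntegral_tendsto_integral_Iic x hint.integrableOn tendsto_id
  have h2 : Tendsto (fun y : ℝ => Complex.exp (κ * y) * (v y - κ * u y)) atBot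
      (𝓝 (Complex.exp (κ * x) * (v x - κ * u x) -
        ∫ t in Iic x, Complex.exp (κ * t) * (V t * u t))) := by
    refine (tendsto_const_nhds.sub h1).congr fun y => ?_
    have : ∫ t in id y..x, Complex.exp (κ * t) * (V t * u t) =
        ∫ t in y..x, Complex.exp (κ * t) * (w t - κ ^ 2 * u t) := by
      refine intervalIntegral.integral_congr_ae ?_
      filter_upwards [hw] with t ht _
      rw [ht]
    rw [this, h.integral_exp_mul]
    ring
  refine sub_eq_zero.1 (eq_zero_of_tendsto_of_norm_le_memLp (fun _ => volume_eq_top_of_mem_atBot)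
    (hv.sub (hu.const_mul κ)) h2 ?_)
  filter_upwards [eventually_le_atBot 0] with y hy
  rw [norm_mul, Complex.norm_exp]
  refine mul_le_of_le_one_left (norm_nonneg _) (Real.exp_le_one_iff.2 ?_)
  simpa using mul_nonpos_of_nonneg_of_nonpos hκ hy

/-- The counterpart at `+∞` of `HasACSecondDeriv.exp_mul_eq_integral_Iic`. -/
theorem HasACSecondDeriv.exp_mul_eq_integral_Ioi {V u v w : ℝ → ℂ} (hV : HasExpMoments V)
    (h : HasACSecondDeriv u v w) (hu : MemLp u 2 volume) (hv : MemLp v 2 volume) {κ : ℂ}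
    (hκ : 0 ≤ κ.re) (hw : ∀ᵐ x, w x - κ ^ 2 * u x = V x * u x) (x : ℝ) :
    Complex.exp (-κ * x) * (v x + κ * u x) =
      -∫ t in Ioi x, Complex.exp (-κ * t) * (V t * u t) := by
  obtain ⟨C, hC⟩ := h.bounded hu hv
  have hint := hV.integrable_mul_exp h.continuous hC (-κ)
  have h1 := intervalIntegral_tendsto_integral_Ioi x hint.integrableOn tendsto_id
  have h2 : Tendsto (fun y : ℝ => Complex.exp (-κ * y) * (v y + κ * u y)) atTop
      (𝓝 (Complex.exp (-κ * x) * (v x + κ * u x) +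
        ∫ t in Ioi x, Complex.exp (-κ * t) * (V t * u t))) := by
    refine (tendsto_const_nhds.add h1).congr fun y => ?_
    have : ∫ t in x..id y, Complex.exp (-κ * t) * (V t * u t) =
        ∫ t in x..y, Complex.exp (-κ * t) * (w t - (-κ) ^ 2 * u t) := by
      refine intervalIntegral.integral_congr_ae ?_
      filter_upwards [hw] with t ht _
      rw [neg_sq, ht]
    rw [this, h.integral_exp_mul]
    ring
  refine eq_neg_of_add_eq_zero_left (eq_zero_of_tendsto_of_norm_le_memLp
    (fun _ => volume_eq_top_of_mem_atTop) (hv.add (hu.const_mul κ)) h2 ?_)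
  filter_upwards [eventually_ge_atTop 0] with y hy
  rw [norm_mul, Complex.norm_exp]
  refine mul_le_of_le_one_left (norm_nonneg _) (Real.exp_le_one_iff.2 ?_)
  simpa using mul_nonneg hκ hy

/-! ### Volterra operators on bounded continuous functions -/

/-- The mass `∫_{-∞}^x |U|`. -/
noncomputable def cumulativeMass (U : ℝ → ℂ) (x : ℝ) : ℝ := ∫ t in Iic x, ‖U t‖

section cumulativeMass

variable {U : ℝ → ℂ}

theorem cumulativeMass_sub (hU : Integrable U volume) (a b : ℝ) :
    cumulativeMass U b - cumulativeMass U a = ∫ t in a..b, ‖U t‖ :=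
  intervalIntegral.integral_Iic_sub_Iic hU.norm.integrableOn hU.norm.integrableOn

theorem cumulativeMass_nonneg (x : ℝ) : 0 ≤ cumulativeMass U x :=
  integral_nonneg fun _ => norm_nonneg _

theorem cumulativeMass_le (hU : Integrable U volume) (x : ℝ) :
    cumulativeMass U x ≤ ∫ t, ‖U t‖ :=
  setIntegral_le_integral hU.norm (Eventually.of_forall fun _ => norm_nonneg _)

theorem cumulativeMass_eq (hU : Integrable U volume) :
    cumulativeMass U = fun x => cumulativeMass U 0 + ∫ t in (0 : ℝ)..x, ‖U t‖ := by
  funext x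
  rw [← cumulativeMass_sub hU]
  ring

theorem monotone_cumulativeMass (hU : Integrable U volume) : Monotone (cumulativeMass U) := by
  intro a b hab
  have h := cumulativeMass_sub hU a b
  have : 0 ≤ ∫ t in a..b, ‖U t‖ := intervalIntegral.integral_nonneg hab fun _ _ => norm_nonneg _
  linarith

theorem continuous_cumulativeMass (hU : Integrable U volume) : Continuous (cumulativeMass U) := by
  rw [cumulativeMass_eq hU]
  exact continuous_const.add (intervalIntegral.continuous_primitive
    (fun a b => hU.norm.intervalIntegrable) 0)

theorem ae_hasDerivAt_cumulativeMass (hU : Integrable U volume) :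
    ∀ᵐ x, HasDerivAt (cumulativeMass U) ‖U x‖ x := by
  filter_upwards [LocallyIntegrable.ae_hasDerivAt_integral hU.norm.locallyIntegrable] with x hx
  rw [cumulativeMass_eq hU]
  exact (hx 0).const_add _

theorem integrable_exp_cumulativeMass_mul (hU : Integrable U volume) :
    Integrable (fun t => Real.exp (2 * cumulativeMass U t) * ‖U t‖) volume := by
  refine hU.norm.bdd_mul (c := Real.exp (2 * ∫ t, ‖U t‖)) ?_ (Eventually.of_forall fun t => ?_)
  · have := continuous_cumulativeMass hU
    exact Continuous.aestronglyMeasurable (by fun_prop)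
  · rw [Real.norm_eq_abs, Real.abs_exp]
    gcongr
    exact cumulativeMass_le hU t

/-- The Gronwall weight: integrating `|U|e^{2F}` with `F = ∫_{-∞}^x |U|` gains a factor `1/2`. -/
theorem integral_exp_cumulativeMass_mul_le (hU : Integrable U volume) (x : ℝ) :
    ∫ t in Iic x, Real.exp (2 * cumulativeMass U t) * ‖U t‖ ≤
      Real.exp (2 * cumulativeMass U x) / 2 := by
  refine le_of_tendsto (intervalIntegral_tendsto_integral_Iic x
    (integrable_exp_cumulativeMass_mul hU).integrableOn tendsto_id) ?_
  filter_upwards [eventually_le_atBot x] with a ha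
  have hmono : MonotoneOn (fun t => Real.exp (2 * cumulativeMass U t)) (uIcc a x) := by
    refine Monotone.monotoneOn (fun s t hst => ?_) _
    have := monotone_cumulativeMass hU hst
    gcongr
  have hmem := hmono.intervalIntegral_deriv_mem_uIcc
  have hle := hmono left_mem_uIcc right_mem_uIcc ha
  rw [uIcc_of_le (by linarith)] at hmem
  have heq : ∫ t in a..x, deriv (fun t => Real.exp (2 * cumulativeMass U t)) t =
      ∫ t in a..x, 2 * (Real.exp (2 * cumulativeMass U t) * ‖U t‖) := by
    refine intervalIntegral.integral_congr_ae ?_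
    filter_upwards [ae_hasDerivAt_cumulativeMass hU] with t ht _
    rw [(ht.const_mul 2).exp.deriv]
    ring
  rw [heq, intervalIntegral.integral_const_mul] at hmem
  have := hmem.2
  have := Real.exp_pos (2 * cumulativeMass U a)
  simp only [id]
  linarith

end cumulativeMass

/-- The Volterra operator with kernel `e^{-2F(x)} p(x,t) e^{2F(t)} U(t)`, `t ≤ x`, where
`F = ∫_{-∞}^x |U|`, as a function. -/
noncomputable def volterraFun (U : ℝ → ℂ) (p : ℝ × ℝ →ᵇ ℂ) (n : ℝ →ᵇ ℂ) (x : ℝ) : ℂ :=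
  (Real.exp (-(2 * cumulativeMass U x)) : ℂ) *
    ∫ t in Iic x, p (x, t) * ((Real.exp (2 * cumulativeMass U t) : ℂ) * (U t * n t))

section volterra

variable {U : ℝ → ℂ}

theorem norm_volterra_integrand_le (p : ℝ × ℝ →ᵇ ℂ) (n : ℝ →ᵇ ℂ) (x t : ℝ) :
    ‖p (x, t) * ((Real.exp (2 * cumulativeMass U t) : ℂ) * (U t * n t))‖ ≤
      ‖p‖ * ‖n‖ * (Real.exp (2 * cumulativeMass U t) * ‖U t‖) := by
  rw [norm_mul, norm_mul, norm_mul, Complex.norm_real, Real.norm_eq_abs, Real.abs_exp]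
  calc ‖p (x, t)‖ * (Real.exp (2 * cumulativeMass U t) * (‖U t‖ * ‖n t‖)) ≤
        ‖p‖ * (Real.exp (2 * cumulativeMass U t) * (‖U t‖ * ‖n‖)) := by
        gcongr
        · exact p.norm_coe_le_norm _
        · exact n.norm_coe_le_norm _
    _ = _ := by ring

theorem aestronglyMeasurable_volterra_integrand (hU : Integrable U volume) (p : ℝ × ℝ →ᵇ ℂ)
    (n : ℝ →ᵇ ℂ) (x : ℝ) : AEStronglyMeasurable (fun t =>
      p (x, t) * ((Real.exp (2 * cumulativeMass U t) : ℂ) * (U t * n t))) volume := by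
  have := continuous_cumulativeMass hU
  refine AEStronglyMeasurable.mul (Continuous.aestronglyMeasurable (by fun_prop))
    (AEStronglyMeasurable.mul (Continuous.aestronglyMeasurable (by fun_prop))
      (hU.1.mul n.continuous.aestronglyMeasurable))

theorem integrable_volterra_integrand (hU : Integrable U volume) (p : ℝ × ℝ →ᵇ ℂ)
    (n : ℝ →ᵇ ℂ) (x : ℝ) : Integrable (fun t =>
      p (x, t) * ((Real.exp (2 * cumulativeMass U t) : ℂ) * (U t * n t))) volume :=
  ((integrable_exp_cumulativeMass_mul hU).const_mul (‖p‖ * ‖n‖)).mono'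
    (aestronglyMeasurable_volterra_integrand hU p n x)
    (Eventually.of_forall fun t => norm_volterra_integrand_le p n x t)

theorem continuous_volterraFun (hU : Integrable U volume) (p : ℝ × ℝ →ᵇ ℂ) (n : ℝ →ᵇ ℂ) :
    Continuous (volterraFun U p n) := by
  have hF := continuous_cumulativeMass hU
  refine Continuous.mul (by fun_prop) ?_
  simp only [← integral_indicator measurableSet_Iic]
  refine continuous_iff_continuousAt.2 fun x₀ => continuousAt_of_dominated
    (bound := fun t => ‖p‖ * ‖n‖ * (Real.exp (2 * cumulativeMass U t) * ‖U t‖))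
    (Eventually.of_forall fun x =>
      (aestronglyMeasurable_volterra_integrand hU p n x).indicator measurableSet_Iic)
    (Eventually.of_forall fun x => Eventually.of_forall fun t =>
      (norm_indicator_le_norm_self _ _).trans (norm_volterra_integrand_le p n x t))
    ((integrable_exp_cumulativeMass_mul hU).const_mul _) ?_
  -- The indicator of `t ≤ x` is continuous in `x` at `x₀` except for the null set `t = x₀`.
  filter_upwards [compl_mem_ae_iff.2 (measure_singleton (μ := volume) x₀)] with t ht
  rcases lt_or_gt_of_ne (show t ≠ x₀ from ht) with h | h
  · have hc : ContinuousAt (fun x =>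
        p (x, t) * ((Real.exp (2 * cumulativeMass U t) : ℂ) * (U t * n t))) x₀ := by fun_prop
    refine hc.congr ?_
    filter_upwards [lt_mem_nhds h] with x hx
    rw [indicator_of_mem (show t ∈ Iic x from le_of_lt hx)]
  · refine (continuousAt_const (y := (0 : ℂ))).congr ?_
    filter_upwards [gt_mem_nhds h] with x hx
    rw [indicator_of_notMem (show t ∉ Iic x from not_le.2 hx)]

theorem norm_volterraFun_le (hU : Integrable U volume) (p : ℝ × ℝ →ᵇ ℂ) (n : ℝ →ᵇ ℂ) (x : ℝ) :
    ‖volterraFun U p n x‖ ≤ 1 / 2 * ‖p‖ * ‖n‖ := by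
  rw [volterraFun, norm_mul, Complex.norm_real, Real.norm_eq_abs, Real.abs_exp]
  have h1 := norm_integral_le_of_norm_le (μ := volume.restrict (Iic x))
    ((integrable_exp_cumulativeMass_mul hU).const_mul (‖p‖ * ‖n‖)).integrableOn
    (Eventually.of_forall fun t => norm_volterra_integrand_le (U := U) p n x t)
  rw [integral_const_mul] at h1
  calc _ ≤ Real.exp (-(2 * cumulativeMass U x)) *
        (‖p‖ * ‖n‖ * (Real.exp (2 * cumulativeMass U x) / 2)) := by
        gcongr
        refine h1.trans ?_
        gcongr
        exact integral_exp_cumulativeMass_mul_le hU x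
    _ = 1 / 2 * ‖p‖ * ‖n‖ := by
        rw [Real.exp_neg]
        field_simp

/-- The Volterra operator `volterraFun` on bounded continuous functions; it depends linearly and
boundedly on the kernel `p`. -/
noncomputable def volterra (hU : Integrable U volume) :
    (ℝ × ℝ →ᵇ ℂ) →L[ℂ] (ℝ →ᵇ ℂ) →L[ℂ] (ℝ →ᵇ ℂ) :=
  LinearMap.mkContinuous₂
    (LinearMap.mk₂ ℂ
      (fun p n => BoundedContinuousFunction.ofNormedAddCommGroup (volterraFun U p n)
        (continuous_volterraFun hU p n) _ (norm_volterraFun_le hU p n))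
      (fun p q n => by
        ext x
        simp only [BoundedContinuousFunction.coe_ofNormedAddCommGroup,
          BoundedContinuousFunction.coe_add, Pi.add_apply, volterraFun, add_mul]
        rw [integral_add (integrable_volterra_integrand hU p n x).integrableOn
          (integrable_volterra_integrand hU q n x).integrableOn, mul_add])
      (fun c p n => by
        ext x
        simp only [BoundedContinuousFunction.coe_ofNormedAddCommGroup,
          BoundedContinuousFunction.coe_smul, smul_eq_mul, volterraFun, mul_assoc]
        rw [integral_const_mul, mul_left_comm])
      (fun p n m => by
        ext x
        simp only [BoundedContinuousFunction.coe_ofNormedAddCommGroup,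
          BoundedContinuousFunction.coe_add, Pi.add_apply, volterraFun, mul_add]
        rw [integral_add (integrable_volterra_integrand hU p n x).integrableOn
          (integrable_volterra_integrand hU p m x).integrableOn, mul_add])
      (fun c p n => by
        ext x
        simp only [BoundedContinuousFunction.coe_ofNormedAddCommGroup,
          BoundedContinuousFunction.coe_smul, smul_eq_mul, volterraFun,
          mul_left_comm _ c]
        rw [integral_const_mul, mul_left_comm]))
    (1 / 2) fun p n => by
      refine BoundedContinuousFunction.norm_ofNormedAddCommGroup_le _ (by positivity)
        (norm_volterraFun_le hU p n)

theorem volterra_apply (hU : Integrable U volume) (p : ℝ × ℝ →ᵇ ℂ) (n : ℝ →ᵇ ℂ) (x : ℝ) :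
    volterra hU p n x = volterraFun U p n x := rfl

theorem norm_volterra_le (hU : Integrable U volume) (p : ℝ × ℝ →ᵇ ℂ) :
    ‖volterra hU p‖ ≤ 1 / 2 * ‖p‖ :=
  ContinuousLinearMap.opNorm_le_bound _ (by positivity) fun n =>
    (BoundedContinuousFunction.norm_le (by positivity)).2 fun x => norm_volterraFun_le hU p n x

end volterra

/-! ### The weighted kernel as a power series in the spectral parameter -/

theorem norm_resolventKernelCoeff_le {R : ℝ} (hR : 0 < R) (k : ℕ) (z : ℝ × ℝ) :
    ‖((-2 : ℂ) ^ k * ((z.1 - z.2 : ℝ) : ℂ) ^ (k + 1) / (k + 1).factorial *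
      (Real.exp (-(2 * R * |z.1| + 2 * R * |z.2|)) : ℂ))‖ ≤ 1 / (2 * R) * R⁻¹ ^ k := by
  have h1 : |z.1 - z.2| ≤ |z.1| + |z.2| := abs_sub _ _
  have h2 := Real.pow_div_factorial_le_exp (2 * R * |z.1 - z.2|) (by positivity) (k + 1)
  have h3 : Real.exp (2 * R * |z.1 - z.2|) * Real.exp (-(2 * R * |z.1| + 2 * R * |z.2|)) ≤ 1 := by
    rw [← Real.exp_add, Real.exp_le_one_iff]
    nlinarith
  simp only [norm_mul, norm_div, norm_pow, norm_neg, Complex.norm_real, Real.norm_eq_abs,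
    Real.abs_exp, Complex.norm_ofNat, Complex.norm_natCast]
  calc 2 ^ k * |z.1 - z.2| ^ (k + 1) / ((k + 1).factorial : ℝ) *
        Real.exp (-(2 * R * |z.1| + 2 * R * |z.2|))
      = 1 / (2 * R) * R⁻¹ ^ k * ((2 * R * |z.1 - z.2|) ^ (k + 1) / ((k + 1).factorial : ℝ) *
        Real.exp (-(2 * R * |z.1| + 2 * R * |z.2|))) := by
        rw [mul_pow (2 * R), mul_pow 2 R, inv_pow, pow_succ 2, pow_succ R]
        field_simp
    _ ≤ 1 / (2 * R) * R⁻¹ ^ k * 1 := by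
        gcongr
        exact (mul_le_mul_of_nonneg_right h2 (Real.exp_pos _).le).trans h3
    _ = _ := mul_one _

/-- The coefficient of `κ^k` in the weighted kernel
`(1 - e^{-2κ(x-t)}) / (2κ) · e^{-2R|x| - 2R|t|}`. -/
noncomputable def resolventKernelCoeff {R : ℝ} (hR : 0 < R) (k : ℕ) : ℝ × ℝ →ᵇ ℂ :=
  BoundedContinuousFunction.ofNormedAddCommGroup _ (by fun_prop) _
    (norm_resolventKernelCoeff_le hR k)

theorem norm_pow_smul_resolventKernelCoeff_le {R : ℝ} (hR : 0 < R) {κ : ℂ} (hκ : ‖κ‖ ≤ R / 2)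
    (k : ℕ) : ‖κ ^ k • resolventKernelCoeff hR k‖ ≤ 1 / (2 * R) * (1 / 2) ^ k := by
  have h1 : ‖resolventKernelCoeff hR k‖ ≤ 1 / (2 * R) * R⁻¹ ^ k :=
    BoundedContinuousFunction.norm_ofNormedAddCommGroup_le _ (by positivity) _
  rw [norm_smul, norm_pow]
  calc ‖κ‖ ^ k * ‖resolventKernelCoeff hR k‖ ≤ (R / 2) ^ k * (1 / (2 * R) * R⁻¹ ^ k) := by gcongr
    _ = 1 / (2 * R) * (R / 2 * R⁻¹) ^ k := by rw [mul_pow]; ring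
    _ = _ := by
      congr 2
      field_simp

theorem hasSum_resolventKernel_bound {R : ℝ} (hR : 0 < R) :
    HasSum (fun k : ℕ => 1 / (2 * R) * (1 / 2 : ℝ) ^ k) (1 / R) := by
  have := hasSum_geometric_two.mul_left (1 / (2 * R))
  convert! this using 1
  field_simp

/-- The kernel `(1 - e^{-2κ(x-t)}) / (2κ) · e^{-2R|x| - 2R|t|}` as a bounded continuous function of
`(x, t)`, defined by its power series in `κ`, which converges for `|κ| ≤ R / 2` and takes care of
the removable singularity at `κ = 0`. -/
noncomputable def resolventKernel {R : ℝ} (hR : 0 < R) (κ : ℂ) : ℝ × ℝ →ᵇ ℂ :=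
  ∑' k, κ ^ k • resolventKernelCoeff hR k

theorem norm_resolventKernel_le {R : ℝ} (hR : 0 < R) {κ : ℂ} (hκ : ‖κ‖ ≤ R / 2) :
    ‖resolventKernel hR κ‖ ≤ 1 / R :=
  tsum_of_norm_bounded (hasSum_resolventKernel_bound hR)
    (norm_pow_smul_resolventKernelCoeff_le hR hκ)

theorem differentiableOn_resolventKernel {R : ℝ} (hR : 0 < R) :
    DifferentiableOn ℂ (resolventKernel hR) (Metric.ball 0 (R / 2)) :=
  Complex.differentiableOn_tsum_of_summable_norm (hasSum_resolventKernel_bound hR).summable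
    (fun k => ((differentiable_id.pow k).smul_const _).differentiableOn) Metric.isOpen_ball
    fun k _ hκ => norm_pow_smul_resolventKernelCoeff_le hR (mem_ball_zero_iff.1 hκ).le k

theorem hasSum_one_sub_exp_div {κ : ℂ} (hκ : κ ≠ 0) (s : ℂ) :
    HasSum (fun k : ℕ => κ ^ k * ((-2) ^ k * s ^ (k + 1) / (k + 1).factorial))
      ((1 - Complex.exp (-2 * κ * s)) / (2 * κ)) := by
  have h1 : HasSum (fun k : ℕ => (-2 * κ * s) ^ k / (k.factorial : ℂ))
      (Complex.exp (-2 * κ * s)) := by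
    rw [Complex.exp_eq_exp_ℂ]
    exact NormedSpace.expSeries_div_hasSum_exp (-2 * κ * s)
  have h2 := (hasSum_nat_add_iff' 1).2 h1
  simp only [Finset.range_one, Finset.sum_singleton, pow_zero, Nat.factorial_zero, Nat.cast_one,
    div_one] at h2
  convert! h2.mul_left (-1 / (2 * κ)) using 1
  · funext k
    rw [pow_succ (-2 * κ * s), mul_pow (-2 * κ), mul_pow (-2) κ, pow_succ s]
    field_simp
  · field_simp
    ring

theorem resolventKernel_apply {R : ℝ} (hR : 0 < R) {κ : ℂ} (hκ : ‖κ‖ ≤ R / 2) (h0 : κ ≠ 0)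
    (x t : ℝ) : resolventKernel hR κ (x, t) =
      (1 - Complex.exp (-2 * κ * ((x - t : ℝ) : ℂ))) / (2 * κ) *
        (Real.exp (-(2 * R * |x| + 2 * R * |t|)) : ℂ) := by
  have hs : Summable fun k => κ ^ k • resolventKernelCoeff hR k :=
    .of_norm_bounded (hasSum_resolventKernel_bound hR).summable
      (norm_pow_smul_resolventKernelCoeff_le hR hκ)
  have h1 := (BoundedContinuousFunction.evalCLM ℂ ((x, t) : ℝ × ℝ)).hasSum hs.hasSum
  refine h1.unique ?_
  convert! (hasSum_one_sub_exp_div h0 ((x - t : ℝ) : ℂ)).mul_right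
    (Real.exp (-(2 * R * |x| + 2 * R * |t|)) : ℂ) using 1
  funext k
  simp [resolventKernelCoeff, mul_assoc]

/-! ### The Jost solution and the Jost function -/

/-- The density `V(t)e^{4R|t|}`, whose modulus is the measure with respect to which the Volterra
equation is solved. -/
noncomputable def weightedPotential (V : ℝ → ℂ) (R t : ℝ) : ℂ :=
  V t * (Real.exp (4 * R * |t|) : ℂ)

/-- The weight `w(x) = e^{2R|x| + 2F(x)}`, where `F(x) = ∫_{-∞}^x |V(t)|e^{4R|t|} dt`. -/
noncomputable def jostWeight (V : ℝ → ℂ) (R x : ℝ) : ℝ :=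
  Real.exp (2 * R * |x| + 2 * cumulativeMass (weightedPotential V R) x)

theorem jostWeight_pos (V : ℝ → ℂ) (R x : ℝ) : 0 < jostWeight V R x := Real.exp_pos _

section jost

variable {V : ℝ → ℂ} {R : ℝ}

theorem integrable_weightedPotential (hV : HasExpMoments V) (R : ℝ) :
    Integrable (weightedPotential V R) volume :=
  hV.integrable_mul (g := fun t => (Real.exp (4 * R * |t|) : ℂ)) (C := 1) (a := 4 * R)
    (by fun_prop) (fun x => by rw [Complex.norm_real, Real.norm_eq_abs, Real.abs_exp, one_mul])

theorem continuous_jostWeight (hV : HasExpMoments V) (R : ℝ) : Continuous (jostWeight V R) := by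
  have := continuous_cumulativeMass (integrable_weightedPotential hV R)
  unfold jostWeight
  fun_prop

theorem jostWeight_le (hV : HasExpMoments V) (R x : ℝ) : jostWeight V R x ≤
    Real.exp (2 * ∫ t, ‖weightedPotential V R t‖) * Real.exp (2 * R * |x|) := by
  rw [← Real.exp_add, add_comm]
  unfold jostWeight
  gcongr
  exact cumulativeMass_le (integrable_weightedPotential hV R) x

theorem integrable_mul_jostWeight (hV : HasExpMoments V) (R : ℝ) :
    Integrable (fun t => V t * (jostWeight V R t : ℂ)) volume := by
  have := continuous_jostWeight hV R
  refine hV.integrable_mul (g := fun t => (jostWeight V R t : ℂ)) (by fun_prop)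
    (C := Real.exp (2 * ∫ t, ‖weightedPotential V R t‖)) (a := 2 * R) fun x => ?_
  rw [Complex.norm_real, Real.norm_eq_abs, abs_of_pos (jostWeight_pos V R x)]
  exact jostWeight_le hV R x

theorem norm_mul_jostWeight_mul_le (n : ℝ →ᵇ ℂ) (t : ℝ) :
    ‖V t * ((jostWeight V R t : ℂ) * n t)‖ ≤ ‖n‖ * ‖V t * (jostWeight V R t : ℂ)‖ := by
  rw [← mul_assoc, norm_mul, mul_comm]
  gcongr
  exact n.norm_coe_le_norm t

theorem integrable_mul_jostWeight_mul (hV : HasExpMoments V) (n : ℝ →ᵇ ℂ) :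
    Integrable (fun t => V t * ((jostWeight V R t : ℂ) * n t)) volume := by
  have := continuous_jostWeight hV R
  exact ((integrable_mul_jostWeight hV R).norm.const_mul ‖n‖).mono'
    (hV.integrable.1.mul (Continuous.aestronglyMeasurable (by fun_prop)))
    (Eventually.of_forall fun t => norm_mul_jostWeight_mul_le n t)

/-- The functional `n ↦ ∫ V w n`. -/
noncomputable def potentialFunctional (hV : HasExpMoments V) (R : ℝ) : (ℝ →ᵇ ℂ) →L[ℂ] ℂ :=
  LinearMap.mkContinuous
    { toFun := fun n => ∫ t, V t * ((jostWeight V R t : ℂ) * n t)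
      map_add' := fun n m => by
        simp only [BoundedContinuousFunction.coe_add, Pi.add_apply, mul_add]
        exact integral_add (integrable_mul_jostWeight_mul hV n)
          (integrable_mul_jostWeight_mul hV m)
      map_smul' := fun c n => by
        simp only [BoundedContinuousFunction.coe_smul, smul_eq_mul, mul_left_comm _ c,
          RingHom.id_apply]
        exact integral_const_mul c _ }
    (∫ t, ‖V t * (jostWeight V R t : ℂ)‖) fun n => by
      rw [mul_comm, ← integral_const_mul]
      exact norm_integral_le_of_norm_le ((integrable_mul_jostWeight hV R).norm.const_mul ‖n‖)
        (Eventually.of_forall fun t => norm_mul_jostWeight_mul_le n t)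

theorem potentialFunctional_apply (hV : HasExpMoments V) (R : ℝ) (n : ℝ →ᵇ ℂ) :
    potentialFunctional hV R n = ∫ t, V t * ((jostWeight V R t : ℂ) * n t) := rfl

/-- The bounded continuous function `1 / w`. -/
noncomputable def invJostWeight (hV : HasExpMoments V) (hR : 0 < R) : ℝ →ᵇ ℂ :=
  BoundedContinuousFunction.ofNormedAddCommGroup (fun x => ((jostWeight V R x)⁻¹ : ℂ))
    (by
      have := continuous_jostWeight hV R
      refine Continuous.inv₀ (by fun_prop) fun x => ?_
      exact_mod_cast (jostWeight_pos V R x).ne')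
    1 fun x => by
      rw [norm_inv, Complex.norm_real, Real.norm_eq_abs, abs_of_pos (jostWeight_pos V R x)]
      refine inv_le_one_of_one_le₀ (Real.one_le_exp ?_)
      have := cumulativeMass_nonneg (U := weightedPotential V R) x
      positivity

/-- The operator `T_κ` on bounded continuous functions for which `y = wn` solves the Volterra
equation `y(x) = c + ∫_{-∞}^x (1 - e^{-2κ(x-t)}) / (2κ) · V(t)y(t) dt` if and only if
`n - T_κ n = c / w`. -/
noncomputable def jostOperator (hV : HasExpMoments V) (hR : 0 < R) (κ : ℂ) :
    (ℝ →ᵇ ℂ) →L[ℂ] (ℝ →ᵇ ℂ) :=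
  volterra (integrable_weightedPotential hV R) (resolventKernel hR κ)

theorem jostWeight_mul_jostOperator_apply (hV : HasExpMoments V) (hR : 0 < R) {κ : ℂ}
    (hκ : ‖κ‖ ≤ R / 2) (h0 : κ ≠ 0) (n : ℝ →ᵇ ℂ) (x : ℝ) :
    (jostWeight V R x : ℂ) * jostOperator hV hR κ n x =
      ∫ t in Iic x, (1 - Complex.exp (-2 * κ * ((x - t : ℝ) : ℂ))) / (2 * κ) *
        (V t * ((jostWeight V R t : ℂ) * n t)) := by
  rw [jostOperator, volterra_apply, volterraFun, ← mul_assoc, ← integral_const_mul]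
  congr 1
  funext t
  rw [resolventKernel_apply hR hκ h0]
  -- All the weights combine to `w(t)`.
  have key : jostWeight V R x * Real.exp (-(2 * cumulativeMass (weightedPotential V R) x)) *
      Real.exp (-(2 * R * |x| + 2 * R * |t|)) *
      Real.exp (2 * cumulativeMass (weightedPotential V R) t) * Real.exp (4 * R * |t|) =
        jostWeight V R t := by
    simp only [jostWeight, ← Real.exp_add]
    congr 1
    ring
  rw [← key, weightedPotential]
  push_cast
  ring

theorem isUnit_one_sub_jostOperator (hV : HasExpMoments V) (hR : 1 ≤ R) {κ : ℂ}
    (hκ : ‖κ‖ ≤ R / 2) : IsUnit (1 - jostOperator hV (zero_lt_one.trans_le hR) κ) := by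
  have h1 := norm_volterra_le (integrable_weightedPotential hV R)
    (resolventKernel (zero_lt_one.trans_le hR) κ)
  have h2 := norm_resolventKernel_le (zero_lt_one.trans_le hR) hκ
  have h3 : 1 / R ≤ 1 := by rw [div_le_one (by linarith)]; exact hR
  exact isUnit_one_sub_of_norm_lt_one (R := (ℝ →ᵇ ℂ) →L[ℂ] (ℝ →ᵇ ℂ))
    (lt_of_le_of_lt h1 (by linarith))

/-- The weighted Jost solution `n_κ = (1 - T_κ)⁻¹ (1 / w)`. Thus `e^{κx} w(x) n_κ(x)` is the
solution of `-f'' + Vf = -κ²f` that behaves like `e^{κx}` at `-∞`. -/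
noncomputable def jostSolution (hV : HasExpMoments V) (hR : 0 < R) (κ : ℂ) : ℝ →ᵇ ℂ :=
  Ring.inverse (1 - jostOperator hV hR κ) (invJostWeight hV hR)

/-- The Jost function `D(κ) = 2κ + ∫ V w n_κ`. -/
noncomputable def jostFunction (hV : HasExpMoments V) (hR : 0 < R) (κ : ℂ) : ℂ :=
  2 * κ + potentialFunctional hV R (jostSolution hV hR κ)

theorem differentiableOn_jostFunction (hV : HasExpMoments V) (hR : 1 ≤ R) :
    DifferentiableOn ℂ (jostFunction hV (zero_lt_one.trans_le hR)) (Metric.ball 0 (R / 2)) := by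
  intro κ hκ
  -- The functions composed below are named explicitly so that the instances found on the spaces of
  -- bounded functions and of operators need only agree by unfolding.
  have hK : DifferentiableWithinAt ℂ (jostOperator hV (zero_lt_one.trans_le hR))
      (Metric.ball 0 (R / 2)) κ :=
    DifferentiableAt.comp_differentiableWithinAt (g := volterra (integrable_weightedPotential hV R))
      κ (by exact ContinuousLinearMap.differentiableAt _)
      (differentiableOn_resolventKernel (zero_lt_one.trans_le hR) κ hκ)
  have hu := isUnit_one_sub_jostOperator hV hR (mem_ball_zero_iff.1 hκ).le
  have hinv : DifferentiableAt ℂ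
      (Ring.inverse : ((ℝ →ᵇ ℂ) →L[ℂ] (ℝ →ᵇ ℂ)) → ((ℝ →ᵇ ℂ) →L[ℂ] (ℝ →ᵇ ℂ)))
      (1 - jostOperator hV (zero_lt_one.trans_le hR) κ) :=
    differentiableAt_inverse (𝕜 := ℂ) (R := (ℝ →ᵇ ℂ) →L[ℂ] (ℝ →ᵇ ℂ)) hu
  have hN := DifferentiableAt.comp_differentiableWithinAt
    (g := (Ring.inverse : ((ℝ →ᵇ ℂ) →L[ℂ] (ℝ →ᵇ ℂ)) → ((ℝ →ᵇ ℂ) →L[ℂ] (ℝ →ᵇ ℂ)))) κ (by exact hinv)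
    (hK.const_sub (1 : (ℝ →ᵇ ℂ) →L[ℂ] (ℝ →ᵇ ℂ)))
  let Φ : ((ℝ →ᵇ ℂ) →L[ℂ] (ℝ →ᵇ ℂ)) →L[ℂ] ℂ := (potentialFunctional hV R).comp
    (ContinuousLinearMap.apply ℂ (ℝ →ᵇ ℂ) (invJostWeight hV (zero_lt_one.trans_le hR)))
  exact (differentiableWithinAt_id.const_mul 2).add
    (DifferentiableAt.comp_differentiableWithinAt (g := Φ) κ
      (by exact ContinuousLinearMap.differentiableAt _) hN)

/-- Solutions of the Volterra equation with growth at most `w` are multiples of the Jost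
solution. -/
theorem eq_smul_jostSolution (hV : HasExpMoments V) (hR : 1 ≤ R) {κ : ℂ} (hκ : ‖κ‖ ≤ R / 2)
    (h0 : κ ≠ 0) {n : ℝ →ᵇ ℂ} {c : ℂ} (hn : ∀ x, (jostWeight V R x : ℂ) * n x =
      c + ∫ t in Iic x, (1 - Complex.exp (-2 * κ * ((x - t : ℝ) : ℂ))) / (2 * κ) *
        (V t * ((jostWeight V R t : ℂ) * n t))) :
    n = c • jostSolution hV (zero_lt_one.trans_le hR) κ := by
  have hR' := zero_lt_one.trans_le hR
  have heq : (1 - jostOperator hV hR' κ) n = c • invJostWeight hV hR' := by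
    ext x
    have hw : (jostWeight V R x : ℂ) ≠ 0 := by exact_mod_cast (jostWeight_pos V R x).ne'
    refine mul_left_cancel₀ hw ?_
    have h1 : ((1 - jostOperator hV hR' κ) n) x = n x - jostOperator hV hR' κ n x := rfl
    have h2 : (c • invJostWeight hV hR') x = c * (jostWeight V R x : ℂ)⁻¹ := rfl
    rw [h1, h2, mul_sub, jostWeight_mul_jostOperator_apply hV hR' hκ h0, hn]
    field_simp
    ring
  have hu := isUnit_one_sub_jostOperator hV hR hκ
  calc n = (Ring.inverse (1 - jostOperator hV hR' κ) * (1 - jostOperator hV hR' κ)) n := by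
        rw [Ring.inverse_mul_cancel _ hu]; rfl
    _ = Ring.inverse (1 - jostOperator hV hR' κ) ((1 - jostOperator hV hR' κ) n) := rfl
    _ = _ := by rw [heq, map_smul]; rfl

theorem jostWeight_mul_jostSolution (hV : HasExpMoments V) (hR : 1 ≤ R) {κ : ℂ}
    (hκ : ‖κ‖ ≤ R / 2) (h0 : κ ≠ 0) (x : ℝ) :
    (jostWeight V R x : ℂ) * jostSolution hV (zero_lt_one.trans_le hR) κ x =
      1 + ∫ t in Iic x, (1 - Complex.exp (-2 * κ * ((x - t : ℝ) : ℂ))) / (2 * κ) *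
        (V t * ((jostWeight V R t : ℂ) * jostSolution hV (zero_lt_one.trans_le hR) κ t)) := by
  have hR' := zero_lt_one.trans_le hR
  have hu := isUnit_one_sub_jostOperator hV hR hκ
  have heq : (1 - jostOperator hV hR' κ) (jostSolution hV hR' κ) = invJostWeight hV hR' := by
    calc _ = ((1 - jostOperator hV hR' κ) * Ring.inverse (1 - jostOperator hV hR' κ))
          (invJostWeight hV hR') := rfl
      _ = _ := by rw [Ring.mul_inverse_cancel _ hu]; rfl
  have hw : (jostWeight V R x : ℂ) ≠ 0 := by exact_mod_cast (jostWeight_pos V R x).ne'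
  have h1 : jostSolution hV hR' κ x - jostOperator hV hR' κ (jostSolution hV hR' κ) x =
      (jostWeight V R x : ℂ)⁻¹ := DFunLike.congr_fun heq x
  rw [← jostWeight_mul_jostOperator_apply hV hR' hκ h0, ← mul_inv_cancel₀ hw, ← h1]
  ring

/-- For real `κ > ‖V‖₁` the Jost solution differs little from `1`, so `D(κ) ≠ 0`. -/
theorem jostFunction_ofReal_ne_zero (hV : HasExpMoments V) (hR : 1 ≤ R) {k : ℝ}
    (hk : ∫ x, ‖V x‖ < k) (hkR : k ≤ R / 2) :
    jostFunction hV (zero_lt_one.trans_le hR) k ≠ 0 := by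
  have hV0 : 0 ≤ ∫ x, ‖V x‖ := integral_nonneg fun _ => norm_nonneg _
  have hk0 : 0 < k := hV0.trans_lt hk
  have hkn : ‖(k : ℂ)‖ ≤ R / 2 := by
    rwa [Complex.norm_real, Real.norm_eq_abs, abs_of_pos hk0]
  have hkc : (k : ℂ) ≠ 0 := by exact_mod_cast hk0.ne'
  set n := jostSolution hV (zero_lt_one.trans_le hR) k with hn
  have hint := integrable_mul_jostWeight_mul (R := R) hV n
  set I := ∫ t, ‖V t * ((jostWeight V R t : ℂ) * n t)‖ with hI
  have hbound : ∀ x, ‖(jostWeight V R x : ℂ) * n x‖ ≤ 1 + 1 / (2 * k) * I := by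
    intro x
    rw [hn, jostWeight_mul_jostSolution hV hR hkn hkc, ← hn]
    refine (norm_add_le _ _).trans ?_
    rw [norm_one]
    gcongr
    calc _ ≤ ∫ t in Iic x, 1 / (2 * k) * ‖V t * ((jostWeight V R t : ℂ) * n t)‖ := by
          refine norm_integral_le_of_norm_le (hint.norm.const_mul _).integrableOn ?_
          refine (ae_restrict_iff' measurableSet_Iic).2 (Eventually.of_forall fun t ht => ?_)
          rw [norm_mul]
          gcongr
          have he : Complex.exp (-2 * k * ((x - t : ℝ) : ℂ)) =
              ((Real.exp (-2 * k * (x - t)) : ℝ) : ℂ) := by push_cast; rfl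
          have he1 : Real.exp (-2 * k * (x - t)) ≤ 1 :=
            Real.exp_le_one_iff.2 (by nlinarith [show t ≤ x from ht])
          have he0 := Real.exp_pos (-2 * k * (x - t))
          rw [he, ← Complex.ofReal_one, ← Complex.ofReal_sub, norm_div, norm_mul,
            Complex.norm_real, Complex.norm_real, Complex.norm_ofNat, Real.norm_eq_abs,
            Real.norm_eq_abs, abs_of_pos hk0, abs_of_nonneg (by linarith)]
          gcongr
          linarith
      _ = 1 / (2 * k) * ∫ t in Iic x, ‖V t * ((jostWeight V R t : ℂ) * n t)‖ :=
          integral_const_mul _ _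
      _ ≤ 1 / (2 * k) * I := by
          gcongr
          exact setIntegral_le_integral hint.norm (Eventually.of_forall fun _ => norm_nonneg _)
  have hIle : I ≤ (∫ x, ‖V x‖) * (1 + 1 / (2 * k) * I) := by
    rw [← integral_mul_const]
    refine integral_mono hint.norm (hV.integrable.norm.mul_const _) fun t => ?_
    simp only [norm_mul (V t)]
    gcongr
    exact hbound t
  have hI0 : 0 ≤ I := integral_nonneg fun _ => norm_nonneg _
  -- `I ≤ ‖V‖₁ + I ‖V‖₁ / (2k) ≤ ‖V‖₁ + I / 2`, hence `I ≤ 2‖V‖₁ < 2k`.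
  have hI2 : I < 2 * k := by
    have h1 : (∫ x, ‖V x‖) * (1 / (2 * k) * I) ≤ k * (1 / (2 * k) * I) := by gcongr
    have h2 : k * (1 / (2 * k) * I) = I / 2 := by field_simp
    linarith
  intro hD
  have h3 : (2 * k : ℂ) = -∫ t, V t * ((jostWeight V R t : ℂ) * n t) := eq_neg_of_add_eq_zero_left hD
  have h4 : ‖(2 * k : ℂ)‖ = 2 * k := by
    rw [norm_mul, Complex.norm_real, Real.norm_eq_abs, abs_of_pos hk0, Complex.norm_ofNat]
  have h5 := norm_integral_le_integral_norm (μ := volume)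
    (fun t => V t * ((jostWeight V R t : ℂ) * n t))
  rw [← norm_neg, ← h3, h4] at h5
  linarith

theorem finite_zeros_jostFunction (hV : HasExpMoments V) (hR : 1 ≤ R) {r : ℝ}
    (hr : ∫ x, ‖V x‖ < r) (hrR : r < R / 2) :
    {κ : ℂ | ‖κ‖ ≤ r ∧ jostFunction hV (zero_lt_one.trans_le hR) κ = 0}.Finite := by
  have hana := (differentiableOn_jostFunction hV hR).analyticOnNhd Metric.isOpen_ball
  have hr0 : 0 < r := lt_of_le_of_lt (integral_nonneg fun _ => norm_nonneg _) hr
  have hmem : (r : ℂ) ∈ Metric.ball (0 : ℂ) (R / 2) := by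
    rwa [mem_ball_zero_iff, Complex.norm_real, Real.norm_eq_abs, abs_of_pos hr0]
  rcases hana.eqOn_zero_or_eventually_ne_zero_of_preconnected
    (convex_ball _ _).isPreconnected with h | h
  · exact absurd (h hmem) (jostFunction_ofReal_ne_zero hV hR hr hrR.le)
  · have hfin := (isCompact_closedBall (0 : ℂ) r).finite_sdiff_of_mem_codiscreteWithin
      (codiscreteWithin_mono (Metric.closedBall_subset_ball hrR) h)
    refine hfin.subset fun κ hκ => ⟨mem_closedBall_zero_iff.2 hκ.1, fun hne => hne hκ.2⟩

end jost

/-! ### Eigenvalues and zeros of the Jost function -/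

section eigenfunction

variable {V u v w : ℝ → ℂ} {κ : ℂ}

/-- An eigenfunction satisfies `2κu = -∫ e^{-κ|x-t|} V(t)u(t) dt`. -/
theorem HasACSecondDeriv.two_mul_mul_eq (hV : HasExpMoments V) (h : HasACSecondDeriv u v w)
    (hu : MemLp u 2 volume) (hv : MemLp v 2 volume) (hκ : 0 ≤ κ.re)
    (hw : ∀ᵐ x, w x - κ ^ 2 * u x = V x * u x) (x : ℝ) :
    2 * κ * u x = -((∫ t in Iic x, Complex.exp (-κ * x) * (Complex.exp (κ * t) * (V t * u t))) +
      ∫ t in Ioi x, Complex.exp (κ * x) * (Complex.exp (-κ * t) * (V t * u t))) := by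
  rw [integral_const_mul, integral_const_mul, ← h.exp_mul_eq_integral_Iic hV hu hv hκ hw]
  have : Complex.exp (κ * x) * Complex.exp (-κ * x) = 1 := by
    rw [← Complex.exp_add]
    simp
  linear_combination (-2 * κ * u x) * this +
    Complex.exp (κ * x) * h.exp_mul_eq_integral_Ioi hV hu hv hκ hw x

theorem HasACSecondDeriv.integrable_mul (hV : HasExpMoments V) (h : HasACSecondDeriv u v w)
    (hu : MemLp u 2 volume) (hv : MemLp v 2 volume) :
    Integrable (fun t => V t * u t) volume := by
  obtain ⟨C, hC⟩ := h.bounded hu hv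
  simpa using hV.integrable_mul_exp h.continuous hC 0

theorem HasACSecondDeriv.norm_two_mul_mul_le (hV : HasExpMoments V) (h : HasACSecondDeriv u v w)
    (hu : MemLp u 2 volume) (hv : MemLp v 2 volume) (hκ : 0 ≤ κ.re)
    (hw : ∀ᵐ x, w x - κ ^ 2 * u x = V x * u x) (x : ℝ) :
    2 * ‖κ‖ * ‖u x‖ ≤ ∫ t, ‖V t * u t‖ := by
  have hint := (h.integrable_mul hV hu hv).norm
  have h1 : ‖2 * κ * u x‖ = 2 * ‖κ‖ * ‖u x‖ := by rw [norm_mul, norm_mul, Complex.norm_ofNat]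
  rw [← h1, h.two_mul_mul_eq hV hu hv hκ hw, norm_neg, ← integral_add_compl measurableSet_Iic hint,
    compl_Iic]
  refine (norm_add_le _ _).trans (add_le_add ?_ ?_)
  · refine norm_integral_le_of_norm_le hint.integrableOn ?_
    refine (ae_restrict_iff' measurableSet_Iic).2 (Eventually.of_forall fun t ht => ?_)
    rw [← mul_assoc, ← Complex.exp_add, norm_mul, Complex.norm_exp]
    refine mul_le_of_le_one_left (norm_nonneg _) (Real.exp_le_one_iff.2 ?_)
    have : t ≤ x := ht
    simp only [Complex.add_re, Complex.mul_re, Complex.neg_re, Complex.ofReal_re,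
      Complex.ofReal_im, mul_zero, sub_zero]
    nlinarith
  · refine norm_integral_le_of_norm_le hint.integrableOn ?_
    refine (ae_restrict_iff' measurableSet_Ioi).2 (Eventually.of_forall fun t ht => ?_)
    rw [← mul_assoc, ← Complex.exp_add, norm_mul, Complex.norm_exp]
    refine mul_le_of_le_one_left (norm_nonneg _) (Real.exp_le_one_iff.2 ?_)
    have : x < t := ht
    simp only [Complex.add_re, Complex.mul_re, Complex.neg_re, Complex.ofReal_re,
      Complex.ofReal_im, mul_zero, sub_zero]
    nlinarith

/-- `-κ²` with `Re κ ≥ 0` can be an eigenvalue only if `2|κ| ≤ ‖V‖₁`. -/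
theorem HasACSecondDeriv.two_mul_norm_le (hV : HasExpMoments V) (h : HasACSecondDeriv u v w)
    (hu : MemLp u 2 volume) (hv : MemLp v 2 volume) (hκ : 0 ≤ κ.re)
    (hw : ∀ᵐ x, w x - κ ^ 2 * u x = V x * u x) (hne : u ≠ 0) :
    2 * ‖κ‖ ≤ ∫ x, ‖V x‖ := by
  have hV0 : 0 ≤ ∫ x, ‖V x‖ := integral_nonneg fun _ => norm_nonneg _
  rcases eq_or_ne κ 0 with rfl | h0
  · simpa using hV0
  have hκ0 : 0 < ‖κ‖ := norm_pos_iff.2 h0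
  have hint := (h.integrable_mul hV hu hv).norm
  have hle := h.norm_two_mul_mul_le hV hu hv hκ hw
  set J := ∫ t, ‖V t * u t‖ with hJ
  obtain ⟨x, hx⟩ := Function.ne_iff.1 hne
  have hJ0 : 0 < J := lt_of_lt_of_le (by have := norm_pos_iff.2 hx; positivity) (hle x)
  have h2 : 2 * ‖κ‖ * J ≤ (∫ x, ‖V x‖) * J := by
    rw [hJ, ← integral_const_mul, ← integral_mul_const, ← hJ]
    refine integral_mono (hint.const_mul _) (hV.integrable.norm.mul_const _) fun t => ?_
    simp only [norm_mul]
    calc 2 * ‖κ‖ * (‖V t‖ * ‖u t‖) = ‖V t‖ * (2 * ‖κ‖ * ‖u t‖) := by ring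
      _ ≤ ‖V t‖ * J := by gcongr; exact hle t
  exact le_of_mul_le_mul_right h2 hJ0

/-- The function `g = e^{-κx}u` satisfies the Volterra equation of the Jost solution. -/
theorem HasACSecondDeriv.exp_neg_mul_eq (hV : HasExpMoments V) (h : HasACSecondDeriv u v w)
    (hu : MemLp u 2 volume) (hv : MemLp v 2 volume) (hκ : 0 ≤ κ.re) (h0 : κ ≠ 0)
    (hw : ∀ᵐ x, w x - κ ^ 2 * u x = V x * u x) (x : ℝ) :
    Complex.exp (-κ * x) * u x = -(∫ t, V t * (Complex.exp (-κ * t) * u t)) / (2 * κ) +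
      ∫ t in Iic x, (1 - Complex.exp (-2 * κ * ((x - t : ℝ) : ℂ))) / (2 * κ) *
        (V t * (Complex.exp (-κ * t) * u t)) := by
  obtain ⟨C, hC⟩ := h.bounded hu hv
  have hi1 : Integrable (fun t : ℝ => V t * (Complex.exp (-κ * t) * u t)) volume :=
    (hV.integrable_mul_exp h.continuous hC (-κ)).congr
      (Eventually.of_forall fun t => by simp only; ring)
  have hi2 := hV.integrable_mul_exp h.continuous hC κ
  have hrep := h.two_mul_mul_eq hV hu hv hκ hw x
  have hsplit := integral_add_compl (measurableSet_Iic (a := x)) hi1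
  rw [compl_Iic] at hsplit
  have hIoi : ∫ t in Ioi x, Complex.exp (κ * x) * (Complex.exp (-κ * t) * (V t * u t)) =
      Complex.exp (κ * x) * ∫ t in Ioi x, V t * (Complex.exp (-κ * t) * u t) := by
    rw [← integral_const_mul]
    congr 1
    funext t
    ring
  have hIic : ∫ t in Iic x, (1 - Complex.exp (-2 * κ * ((x - t : ℝ) : ℂ))) / (2 * κ) *
        (V t * (Complex.exp (-κ * t) * u t)) =
      1 / (2 * κ) * ((∫ t in Iic x, V t * (Complex.exp (-κ * t) * u t)) -
        Complex.exp (-κ * x) *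
          ∫ t in Iic x, Complex.exp (-κ * x) * (Complex.exp (κ * t) * (V t * u t))) := by
    rw [← integral_const_mul, ← integral_sub hi1.integrableOn
      ((hi2.const_mul _).const_mul _).integrableOn, ← integral_const_mul]
    congr 1
    funext t
    have he : Complex.exp (-2 * κ * ((x - t : ℝ) : ℂ)) * Complex.exp (-κ * t) =
        Complex.exp (-κ * x) * (Complex.exp (-κ * x) * Complex.exp (κ * t)) := by
      simp only [← Complex.exp_add]
      congr 1
      push_cast
      ring
    linear_combination (-1 / (2 * κ) * V t * u t) * he
  have hone : Complex.exp (-κ * x) * Complex.exp (κ * x) = 1 := by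
    rw [← Complex.exp_add]
    simp
  rw [hIic, ← hsplit]
  rw [hIoi] at hrep
  have h2κ : (2 * κ) ≠ 0 := mul_ne_zero two_ne_zero h0
  refine mul_left_cancel₀ h2κ ?_
  rw [mul_left_comm, hrep]
  generalize (∫ t in Ioi x, V t * (Complex.exp (-κ * t) * u t)) = B
  generalize (∫ t in Iic x, V t * (Complex.exp (-κ * t) * u t)) = A
  generalize (∫ t in Iic x, Complex.exp (-κ * x) * (Complex.exp (κ * t) * (V t * u t))) = A'
  have hcancel : 2 * κ * (-(A + B) / (2 * κ) +
      1 / (2 * κ) * (A - Complex.exp (-κ * x) * A')) = -B - Complex.exp (-κ * x) * A' := by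
    field_simp
    ring
  rw [hcancel]
  linear_combination (-B) * hone

/-- If `-κ²` with `Re κ ≥ 0`, `κ ≠ 0`, is an eigenvalue, then `κ` is a zero of the Jost
function. -/
theorem HasACSecondDeriv.jostFunction_eq_zero (hV : HasExpMoments V) (h : HasACSecondDeriv u v w)
    (hu : MemLp u 2 volume) (hv : MemLp v 2 volume) (hκ : 0 ≤ κ.re) (h0 : κ ≠ 0)
    (hw : ∀ᵐ x, w x - κ ^ 2 * u x = V x * u x) (hne : u ≠ 0) {R : ℝ} (hR : 1 ≤ R)
    (hκR : ‖κ‖ ≤ R / 2) : jostFunction hV (zero_lt_one.trans_le hR) κ = 0 := by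
  obtain ⟨C, hC⟩ := h.bounded hu hv
  have hwc := continuous_jostWeight hV R
  have hw0 : ∀ x, (jostWeight V R x : ℂ) ≠ 0 := fun x => by
    exact_mod_cast (jostWeight_pos V R x).ne'
  let n : ℝ →ᵇ ℂ := BoundedContinuousFunction.ofNormedAddCommGroup
    (fun x : ℝ => Complex.exp (-κ * x) * u x / (jostWeight V R x : ℂ))
    (by
      have := h.continuous
      exact Continuous.div (by fun_prop) (by fun_prop) hw0) C (fun x => by
      rw [norm_div, Complex.norm_real, Real.norm_eq_abs, abs_of_pos (jostWeight_pos V R x),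
        div_le_iff₀ (jostWeight_pos V R x), norm_mul, Complex.norm_exp, mul_comm]
      have hC0 : 0 ≤ C := (norm_nonneg _).trans (hC 0)
      refine mul_le_mul (hC x) (Real.exp_le_exp.2 ?_) (Real.exp_pos _).le hC0
      have h1 : (-κ * x).re ≤ ‖κ‖ * |x| := by
        refine (Complex.re_le_norm _).trans ?_
        rw [norm_mul, norm_neg, Complex.norm_real, Real.norm_eq_abs]
      have h2 : ‖κ‖ * |x| ≤ 2 * R * |x| := by
        gcongr
        linarith
      have h3 := cumulativeMass_nonneg (U := weightedPotential V R) x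
      linarith)
  have hn : ∀ x, (jostWeight V R x : ℂ) * n x = Complex.exp (-κ * x) * u x := fun x =>
    mul_div_cancel₀ _ (hw0 x)
  set c : ℂ := -(∫ t, V t * (Complex.exp (-κ * t) * u t)) / (2 * κ) with hc
  have heq : n = c • jostSolution hV (zero_lt_one.trans_le hR) κ := by
    refine eq_smul_jostSolution hV hR hκR h0 fun x => ?_
    simp only [hn]
    exact h.exp_neg_mul_eq hV hu hv hκ h0 hw x
  have hc0 : c ≠ 0 := by
    intro hc0
    refine hne (funext fun x => ?_)
    have h1 := hn x
    rw [heq, hc0, zero_smul] at h1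
    have h2 : Complex.exp (-κ * x) * u x = 0 := by rw [← h1]; exact mul_zero _
    exact (mul_eq_zero.1 h2).resolve_left (Complex.exp_ne_zero _)
  have hfun : c * potentialFunctional hV R (jostSolution hV (zero_lt_one.trans_le hR) κ) =
      -(2 * κ * c) := by
    rw [← smul_eq_mul, ← map_smul, ← heq, potentialFunctional_apply]
    simp only [hn]
    rw [hc]
    field_simp
  refine (mul_eq_zero.1 (?_ : c * jostFunction hV (zero_lt_one.trans_le hR) κ = 0)).resolve_left hc0
  rw [jostFunction, mul_add, hfun]
  ring

end eigenfunction

/-- An eigenvalue is of the form `-κ²` with `Re κ ≥ 0`, and it has an eigenfunction in the sense of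
`HasACSecondDeriv`. -/
theorem IsEigenvalue.exists_hasACSecondDeriv {V : ℝ → ℂ} {lam : ℂ}
    (h : IsEigenvalue (schrodinger V) lam) :
    ∃ (κ : ℂ) (u v w : ℝ → ℂ), lam = -κ ^ 2 ∧ 0 ≤ κ.re ∧ HasACSecondDeriv u v w ∧
      MemLp u 2 volume ∧ MemLp v 2 volume ∧ (∀ᵐ x, w x - κ ^ 2 * u x = V x * u x) ∧ u ≠ 0 := by
  obtain ⟨f, hf0, hf⟩ := h
  have hmem : ((f : L2R), schrodinger V f) ∈ schrodingerGraph V := by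
    rw [← schrodinger_graph]
    exact LinearPMap.mem_graph _ f
  obtain ⟨u, v, w, hac, hu, hv, hg⟩ := hmem
  obtain ⟨κ, hκ, hre⟩ : ∃ κ : ℂ, κ ^ 2 = -lam ∧ 0 ≤ κ.re := by
    obtain ⟨κ, hκ⟩ := IsAlgClosed.exists_pow_nat_eq (-lam) two_pos
    rcases le_total 0 κ.re with h | h
    · exact ⟨κ, hκ, h⟩
    · exact ⟨-κ, by rw [neg_sq, hκ], by simpa using h⟩
  refine ⟨κ, u, v, w, by rw [hκ, neg_neg], hre, hac, (memLp_congr_ae hu).1 (Lp.memLp _), hv, ?_, ?_⟩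
  · rw [hf] at hg
    filter_upwards [hg, hu, Lp.coeFn_smul lam (f : L2R)] with x h1 h2 h3
    rw [h3, Pi.smul_apply, h2, smul_eq_mul] at h1
    rw [hκ]
    linear_combination h1
  · rintro rfl
    exact hf0 (Lp.ext (hu.trans (Lp.coeFn_zero _ _ _).symm))

theorem theorem5 (V : ℝ → ℂ)
    (hV : ∀ γ : ℝ, Integrable (fun x : ℝ => V x * ((Real.exp (γ * x) : ℝ) : ℂ)) volume) :
    {lam : ℂ | IsEigenvalue (schrodinger V) lam}.Finite ∧
      ∀ lam : ℂ, IsEigenvalue (schrodinger V) lam →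
        ‖lam‖ ≤ 9 / 4 * (∫ x : ℝ, ‖V x‖) ^ 2 := by
  have hV' : HasExpMoments V := hV
  have hV0 : 0 ≤ ∫ x, ‖V x‖ := integral_nonneg fun _ => norm_nonneg _
  refine ⟨?_, fun lam hlam => ?_⟩
  · -- With `R = 2‖V‖₁ + 4` the Jost function is analytic for `|κ| < ‖V‖₁ + 2`; the disc of radius
    -- `‖V‖₁ + 1` contains every eigenvalue parameter and a point where `D` does not vanish.
    have hR : 1 ≤ 2 * (∫ x, ‖V x‖) + 4 := by linarith
    have hfin := finite_zeros_jostFunction hV' hR (r := (∫ x, ‖V x‖) + 1) (by linarith)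
      (by linarith)
    refine ((hfin.image fun κ => -κ ^ 2).insert 0).subset fun lam hlam => ?_
    obtain ⟨κ, u, v, w, rfl, hre, hac, hu, hv, hw, hne⟩ :=
      IsEigenvalue.exists_hasACSecondDeriv hlam
    rcases eq_or_ne κ 0 with rfl | h0
    · left
      simp
    · right
      have hle := hac.two_mul_norm_le hV' hu hv hre hw hne
      have := norm_nonneg κ
      exact ⟨κ, ⟨by linarith, hac.jostFunction_eq_zero hV' hu hv hre h0 hw hne hR (by linarith)⟩,
        rfl⟩
  · obtain ⟨κ, u, v, w, rfl, hre, hac, hu, hv, hw, hne⟩ :=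
      IsEigenvalue.exists_hasACSecondDeriv hlam
    have hle := hac.two_mul_norm_le hV' hu hv hre hw hne
    rw [norm_neg, norm_pow]
    nlinarith [norm_nonneg κ]
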